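/- Let $(X_1,\|\cdot\|_1)$ and $(X_2,\|\cdot\|_2)$ be reflexive real Banach spaces with $X_2\subset X_1$ densely and continuously, and let $C_N\ge 1$ satisfy $\|v\|_1\le C_N\|v\|_2$ for all $v\in X_2$; accordingly $X_1^*\subset X_2^*$ by restriction. For a functional $F$ on a Banach space $X$ with values in $[0,\infty]$ let $F^*(\xi)=\sup_{v\in X}\big(\langle\xi,v\rangle-F(v)\big)$, $\xi\in X^*$, be its convex conjugate. For $j=1,2$ let $R_j:X_j\to[0,\infty)$ be convex and lower semicontinuous with $R_j(0)=0$, and let $R_j$ and $R_j^*$ be superlinear, i.e. $R_j(v)/\|v\|_j\to\infty$ as $\|v\|_j\to\infty$ and $R_j^*(\xi)/\|\xi\|_{X_j^*}\to\infty$ as $\|\xi\|_{X_j^*}\to\infty$. Let $\overline R_2:X_1\to[0,\infty]$ be equal to $R_2$ on $X_2$ and to $\infty$ on $X_1\setminus X_2$, and define $$R_{\mathrm{eff}}(v)=\inf\{R_1(v_1)+\overline R_2(v_2): v_1,v_2\in X_1,\ v_1+v_2=v\},\qquad v\in X_1.$$ Then: (0) $R_{\mathrm{eff}}$ takes values in $[0,\infty)$,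 and for every $v\in X_1$ the infimum is attained. (1) $R_{\mathrm{eff}}$ is convex and lower semicontinuous on $X_1$, and its conjugate is finite and given by $R_{\mathrm{eff}}^*(\xi)=R_1^*(\xi)+R_2^*(\xi|_{X_2})\in[0,\infty)$ for all $\xi\in X_1^*$. (2) There exists a convex, nondecreasing function $\Psi:[0,\infty)\to[0,\infty)$ with $\Psi(r)/r\to\infty$ as $r\to\infty$ such that, for $j=1,2$, $R_j(v)\ge\Psi(\|v\|_j)$ for all $v\in X_j$ and $R_j^*(\xi)\ge\Psi(\|\xi\|_{X_j^*})$ for all $\xi\in X_j^*$. For every such $\Psi$, with $\Psi^*(s)=\sup_{r\ge0}(rs-\Psi(r))$, $$2\Psi\Big(\frac{1}{2C_N}\|v\|_1\Big)\le R_{\mathrm{eff}}(v)\le R_1(v)\le\Psi^*(\|v\|_1)\qquad\text{for all }v\in X_1.$$ -/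

import Mathlib

open Filter Topology

noncomputable section

namespace InfConvolution

/-- A real normed space is reflexive if the canonical embedding into its bidual is onto. -/
def IsReflexive (X : Type*) [NormedAddCommGroup X] [NormedSpace ℝ X] : Prop :=
  Function.Surjective (NormedSpace.inclusionInDoubleDual ℝ X)

/-- The convex (Legendre-Fenchel) conjugate `F*(ξ) = sup_v (⟨ξ, v⟩ - F v)` on the topological dual.
It is only applied to functionals with values in `[0, ∞]`, so `∞ - ∞` never occurs. -/
def conjugate {X : Type*} [NormedAddCommGroup X] [NormedSpace ℝ X] (F : X → EReal)
    (ξ : StrongDual ℝ X) : EReal :=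
  ⨆ v : X, ((ξ v : ℝ) : EReal) - F v

/-- Superlinear dissipation potentials: `R : X → [0, ∞)` is convex, lower semicontinuous,
`R 0 = 0`, and `R` and `R*` grow superlinearly. (Finiteness of `R*` is a consequence of the
superlinear growth of `R`.) -/
structure IsDissipationPotential {X : Type*} [NormedAddCommGroup X] [NormedSpace ℝ X]
    (R : X → ℝ) : Prop where
  nonneg : ∀ v, 0 ≤ R v
  zero : R 0 = 0
  convex : ConvexOn ℝ Set.univ R
  lsc : LowerSemicontinuous R
  superlinear : Tendsto (fun v => R v / ‖v‖) (Bornology.cobounded X) atTop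
  conjugate_superlinear :
    Tendsto (fun ξ : StrongDual ℝ X => conjugate (fun v => (R v : EReal)) ξ / ((‖ξ‖ : ℝ) : EReal))
      (Bornology.cobounded (StrongDual ℝ X)) (𝓝 ⊤)

/-- `Ψ : [0, ∞) → [0, ∞)` (only the values of `Ψ` on `[0, ∞)` matter) is convex, nondecreasing and
superlinear, and `Ψ ∘ ‖·‖` bounds both `R` and `R*` from below, for `R = R₁` and `R = R₂`. -/
structure IsSuperlinearMinorant {X₁ X₂ : Type*} [NormedAddCommGroup X₁] [NormedSpace ℝ X₁]
    [NormedAddCommGroup X₂] [NormedSpace ℝ X₂] (R₁ : X₁ → ℝ) (R₂ : X₂ → ℝ) (Ψ : ℝ → ℝ) : Prop where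
  nonneg : ∀ r, 0 ≤ r → 0 ≤ Ψ r
  convex : ConvexOn ℝ (Set.Ici 0) Ψ
  mono : MonotoneOn Ψ (Set.Ici 0)
  superlinear : Tendsto (fun r => Ψ r / r) atTop atTop
  le₁ : ∀ v, Ψ ‖v‖ ≤ R₁ v
  le₂ : ∀ v, Ψ ‖v‖ ≤ R₂ v
  le_conjugate₁ : ∀ ξ : StrongDual ℝ X₁, (Ψ ‖ξ‖ : EReal) ≤ conjugate (fun v => (R₁ v : EReal)) ξ
  le_conjugate₂ : ∀ ξ : StrongDual ℝ X₂, (Ψ ‖ξ‖ : EReal) ≤ conjugate (fun v => (R₂ v : EReal)) ξ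

/-- The conjugate `Ψ*(s) = sup_{r ≥ 0} (r s - Ψ r)` of a function on `[0, ∞)`. -/
def halfLineConjugate (Ψ : ℝ → ℝ) (s : ℝ) : EReal :=
  ⨆ r : Set.Ici (0 : ℝ), (((r : ℝ) * s - Ψ r : ℝ) : EReal)

/-- The extension of `R₂ : X₂ → ℝ` to `X₁` by `∞` outside the image of the embedding
`ι : X₂ → X₁`. -/
def extendByTop {X₁ X₂ : Type*} (ι : X₂ → X₁) (R₂ : X₂ → ℝ) : X₁ → EReal :=
  Function.extend ι (fun w => (R₂ w : EReal)) (fun _ => ⊤)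

/-- The infimal convolution of two `[0, ∞]`-valued functionals. -/
def infConv {X : Type*} [Add X] (F G : X → EReal) (v : X) : EReal :=
  ⨅ (p : X × X) (_ : p.1 + p.2 = v), F p.1 + G p.2

/-- The effective dissipation potential `v ↦ inf_{v₁ + v₂ = v} R₁ v₁ + R̄₂ v₂` on `X₁`, where `R̄₂`
extends `R₂` by `∞`. -/
def effectivePotential {X₁ X₂ : Type*} [Add X₁] (ι : X₂ → X₁) (R₁ : X₁ → ℝ) (R₂ : X₂ → ℝ) :
    X₁ → EReal :=
  infConv (fun v => (R₁ v : EReal)) (extendByTop ι R₂)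

end InfConvolution

end

open Filter Topology

namespace InfConvolution

/-! Superlinear growth of `R*` makes `R` continuous: `R* ξ ≥ ‖ξ‖ - C` bounds all affine minorants `ξ
v - R* ξ` by `C` on the unit ball, hence `R` too by Fenchel–Moreau, and a convex function bounded
above near a point is continuous. For fixed `v`, the map `w ↦ R₁ (v - ι w) + R₂ w` is convex, lower
semicontinuous and coercive on the reflexive space `X₂`, so the infimum is attained. As the marginal
of a jointly convex function, `R_eff` is convex; being dominated by the continuous `R₁`, it is
continuous, so lower semicontinuity needs no passage to weak limits. In the conjugate, the supremum
over `v + ι w` separates into two independent suprema. The lower bound is the triangle inequality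
followed by midpoint convexity of `Ψ`; the upper bound is Fenchel–Moreau with `R₁* ≥ Ψ ∘ ‖·‖`. -/

/-- A convex function that is bounded above near one point is continuous. -/
theorem _root_.ConvexOn.continuous_of_isBoundedUnder {X : Type*} [NormedAddCommGroup X]
    [NormedSpace ℝ X] {f : X → ℝ} (hf : ConvexOn ℝ Set.univ f) {x₀ : X}
    (h : (𝓝 x₀).IsBoundedUnder (· ≤ ·) f) : Continuous f := by
  have h' : ∃ x₀ ∈ Set.univ, (𝓝 x₀).IsBoundedUnder (· ≤ ·) f := ⟨x₀, Set.mem_univ x₀, h⟩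
  exact continuousOn_univ.1
    (((hf.continuousOn_tfae isOpen_univ Set.univ_nonempty).out 3 1).1 h')

/-! ### The direct method in reflexive spaces. -/

section Reflexive

variable {X : Type*} [NormedAddCommGroup X] [NormedSpace ℝ X]

/-- A point strictly below the graph of a convex lower semicontinuous function lies on the graph of
a continuous affine minorant. -/
theorem exists_affine_minorant {f : X → ℝ} (hf : ConvexOn ℝ Set.univ f)
    (hlsc : LowerSemicontinuous f) {x : X} {a : ℝ} (h : a < f x) :
    ∃ (ξ : StrongDual ℝ X) (c : ℝ), (∀ y, ξ y + c ≤ f y) ∧ ξ x + c = a := by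
  obtain ⟨ξ, c, hle, heq⟩ := hf.exists_affine_le_of_lt (𝕜 := ℝ) (Set.mem_univ x) h isClosed_univ
    (lowerSemicontinuousOn_univ_iff.2 hlsc)
  exact ⟨ξ, c, fun y => by simpa using hle ⟨y, Set.mem_univ y⟩, by simpa using heq⟩

/-- A convex, lower semicontinuous and coercive function on a reflexive space has a minimizer. -/
theorem IsReflexive.exists_forall_le (hX : IsReflexive X) {f : X → ℝ}
    (hf : ConvexOn ℝ Set.univ f) (hlsc : LowerSemicontinuous f)
    (hcoer : Tendsto f (Bornology.cobounded X) atTop) : ∃ x, ∀ y, f x ≤ f y := by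
  obtain ⟨ρ, hρ, hfar⟩ : ∃ ρ : ℝ, 0 ≤ ρ ∧ ∀ y, ρ < ‖y‖ → f 0 ≤ f y := by
    have h := hcoer.eventually_ge_atTop (f 0)
    rw [← comap_norm_atTop, eventually_comap] at h
    obtain ⟨ρ, hρ⟩ := eventually_atTop.1 h
    exact ⟨max ρ 0, le_max_right _ _, fun y hy => hρ _ ((le_max_left _ _).trans hy.le) y rfl⟩
  choose s hs using hX
  have hs_apply (φ : StrongDual ℝ (StrongDual ℝ X)) (ξ : StrongDual ℝ X) : φ ξ = ξ (s φ) := by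
    conv_lhs => rw [← hs φ]
    rfl
  have hs_incl (x : X) : s (NormedSpace.inclusionInDoubleDual ℝ X x) = x :=
    (NormedSpace.inclusionInDoubleDualLi (E := X) ℝ).injective (hs _)
  -- By reflexivity `f` transfers to the bidual, whose balls are weak-* compact (Banach–Alaoglu).
  -- Affine minorants become weak-* continuous there, so `g` is weak-* lower semicontinuous.
  let g : WeakDual ℝ (StrongDual ℝ X) → ℝ := fun φ => f (s (WeakDual.toStrongDual φ))
  have hg : LowerSemicontinuous g := by
    intro φ a ha
    obtain ⟨b, hab, hb⟩ := exists_between ha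
    obtain ⟨ξ, c, hle, heq⟩ := exists_affine_minorant hf hlsc hb
    have hφ : a < φ ξ + c := by
      have : φ ξ = ξ (s (WeakDual.toStrongDual φ)) := hs_apply _ ξ
      rw [this, heq]
      exact hab
    have hcont : Continuous fun ψ : WeakDual ℝ (StrongDual ℝ X) => ψ ξ + c :=
      (WeakDual.eval_continuous ξ).add continuous_const
    filter_upwards [hcont.continuousAt.eventually (lt_mem_nhds hφ)] with ψ hψ
    have : ψ ξ = ξ (s (WeakDual.toStrongDual ψ)) := hs_apply _ ξ
    rw [this] at hψ
    exact hψ.trans_le (hle _)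
  have hK := WeakDual.isCompact_closedBall (𝕜 := ℝ) (0 : StrongDual ℝ (StrongDual ℝ X)) ρ
  have hmem (y : X) (hy : ‖y‖ ≤ ρ) :
      StrongDual.toWeakDual (NormedSpace.inclusionInDoubleDual ℝ X y) ∈
        WeakDual.toStrongDual ⁻¹' Metric.closedBall (0 : StrongDual ℝ (StrongDual ℝ X)) ρ := by
    change NormedSpace.inclusionInDoubleDual ℝ X y ∈ Metric.closedBall _ _
    refine (mem_closedBall_zero_iff (E := StrongDual ℝ (StrongDual ℝ X))).2 ?_
    exact (NormedSpace.double_dual_bound ℝ X y).trans hy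
  obtain ⟨φ, -, hmin⟩ := LowerSemicontinuousOn.exists_isMinOn ⟨_, hmem 0 (by simpa using hρ)⟩ hK
    (hg.lowerSemicontinuousOn _)
  have hball (y : X) (hy : ‖y‖ ≤ ρ) : g φ ≤ f y := by
    have h : g φ ≤ f (s (NormedSpace.inclusionInDoubleDual ℝ X y)) := hmin (hmem y hy)
    rwa [hs_incl] at h
  refine ⟨s (WeakDual.toStrongDual φ), fun y => ?_⟩
  rcases le_or_gt ‖y‖ ρ with hy | hy
  · exact hball y hy
  · exact (hball 0 (by simpa using hρ)).trans (hfar y hy)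

end Reflexive

/-! ### Growth, conjugation and continuity of a single potential. -/

section Superlinear

variable {X : Type*} [NormedAddCommGroup X]

/-- A nonnegative function of superlinear growth dominates every affine function of the norm, up to
a constant. -/
theorem exists_mul_norm_sub_le {f : X → ℝ} (hf : ∀ v, 0 ≤ f v)
    (h : Tendsto (fun v => f v / ‖v‖) (Bornology.cobounded X) atTop) (M : ℝ) :
    ∃ C, 0 ≤ C ∧ ∀ v, M * ‖v‖ - C ≤ f v := by
  have h' := h.eventually_ge_atTop M
  rw [← comap_norm_atTop, eventually_comap] at h'
  obtain ⟨ρ, hρ⟩ := eventually_atTop.1 h'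
  refine ⟨|M| * |ρ|, by positivity, fun v => ?_⟩
  rcases le_or_gt ‖v‖ |ρ| with hv | hv
  · have h₁ : M * ‖v‖ ≤ |M| * |ρ| :=
      mul_le_mul (le_abs_self M) hv (norm_nonneg v) (abs_nonneg M)
    linarith [hf v]
  · have hv0 : 0 < ‖v‖ := (abs_nonneg ρ).trans_lt hv
    have h₁ := hρ ‖v‖ ((le_abs_self ρ).trans hv.le) v rfl
    rw [le_div_iff₀ hv0] at h₁
    nlinarith [mul_nonneg (abs_nonneg M) (abs_nonneg ρ)]

end Superlinear

section Potential

variable {X : Type*} [NormedAddCommGroup X] [NormedSpace ℝ X]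

theorem coe_sub_le_conjugate (R : X → ℝ) (ξ : StrongDual ℝ X) (v : X) :
    ((ξ v - R v : ℝ) : EReal) ≤ conjugate (fun v => (R v : EReal)) ξ := by
  rw [EReal.coe_sub]
  exact le_iSup (fun v : X => ((ξ v : ℝ) : EReal) - (R v : EReal)) v

theorem conjugate_le_coe {R : X → ℝ} {ξ : StrongDual ℝ X} {c : ℝ} (h : ∀ v, ξ v - R v ≤ c) :
    conjugate (fun v => (R v : EReal)) ξ ≤ (c : EReal) := by
  refine iSup_le fun v => ?_
  rw [← EReal.coe_sub]
  exact EReal.coe_le_coe_iff.2 (h v)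

namespace IsDissipationPotential

variable {R : X → ℝ}

/-- The conjugate of a dissipation potential is finite; its real-valued version has superlinear
growth. -/
theorem exists_real_conjugate (hR : IsDissipationPotential R) :
    ∃ S : StrongDual ℝ X → ℝ,
      (∀ ξ, conjugate (fun v => (R v : EReal)) ξ = (S ξ : EReal)) ∧ (∀ ξ, 0 ≤ S ξ) ∧
      Tendsto (fun ξ => S ξ / ‖ξ‖) (Bornology.cobounded (StrongDual ℝ X)) atTop := by
  have hnonneg (ξ : StrongDual ℝ X) : 0 ≤ conjugate (fun v => (R v : EReal)) ξ := by
    simpa [hR.zero] using coe_sub_le_conjugate R ξ 0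
  have hfin (ξ : StrongDual ℝ X) : conjugate (fun v => (R v : EReal)) ξ ≠ ⊤ := by
    -- Slope `‖ξ‖` absorbs the linear term `ξ v`.
    obtain ⟨C, -, hC⟩ := exists_mul_norm_sub_le hR.nonneg hR.superlinear ‖ξ‖
    refine ne_top_of_le_ne_top (EReal.coe_ne_top C) (conjugate_le_coe fun v => ?_)
    linarith [hC v, (le_abs_self (ξ v)).trans (ξ.le_opNorm v)]
  have hcoe (ξ : StrongDual ℝ X) : conjugate (fun v => (R v : EReal)) ξ =
      ((conjugate (fun v => (R v : EReal)) ξ).toReal : EReal) :=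
    (EReal.coe_toReal (hfin ξ) (ne_bot_of_le_ne_bot EReal.zero_ne_bot (hnonneg ξ))).symm
  refine ⟨fun ξ => (conjugate (fun v => (R v : EReal)) ξ).toReal, hcoe,
    fun ξ => EReal.toReal_nonneg (hnonneg ξ), ?_⟩
  rw [← EReal.tendsto_coe_nhds_top_iff]
  refine hR.conjugate_superlinear.congr fun ξ => ?_
  rw [EReal.coe_div, ← hcoe]

/-- The Fenchel–Moreau inequality: an upper bound for all the affine minorants
`ξ ↦ ⟨ξ, v⟩ - R* ξ` bounds `R`. -/
theorem le_of_forall_sub_conjugate_le (hR : IsDissipationPotential R) {S : StrongDual ℝ X → ℝ}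
    (hS : ∀ ξ, conjugate (fun v => (R v : EReal)) ξ = (S ξ : EReal)) {v : X} {b : ℝ}
    (h : ∀ ξ : StrongDual ℝ X, ξ v - S ξ ≤ b) : R v ≤ b := by
  refine le_of_forall_lt fun a ha => ?_
  obtain ⟨a', haa', ha'⟩ := exists_between ha
  obtain ⟨ξ, c, hle, heq⟩ := exists_affine_minorant hR.convex hR.lsc ha'
  -- An affine minorant with slope `ξ` and intercept `c` says exactly that `R* ξ ≤ -c`.
  have hSc : S ξ ≤ -c := by
    rw [← EReal.coe_le_coe_iff, ← hS]
    exact conjugate_le_coe fun y => by linarith [hle y]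
  linarith [h ξ]

theorem exists_bound_unitBall (hR : IsDissipationPotential R) : ∃ C, ∀ v, ‖v‖ ≤ 1 → R v ≤ C := by
  obtain ⟨S, hS, hS0, hSt⟩ := hR.exists_real_conjugate
  obtain ⟨C, -, hC⟩ := exists_mul_norm_sub_le hS0 hSt 1
  refine ⟨C, fun v hv => hR.le_of_forall_sub_conjugate_le hS fun ξ => ?_⟩
  have h₁ : ξ v ≤ ‖ξ‖ :=
    (le_abs_self _).trans ((ξ.le_opNorm v).trans (mul_le_of_le_one_right (norm_nonneg ξ) hv))
  linarith [hC ξ]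

theorem continuous (hR : IsDissipationPotential R) : Continuous R := by
  obtain ⟨C, hC⟩ := hR.exists_bound_unitBall
  refine hR.convex.continuous_of_isBoundedUnder (x₀ := 0) ⟨C, ?_⟩
  rw [eventually_map]
  filter_upwards [Metric.closedBall_mem_nhds (0 : X) one_pos] with v hv
  exact hC v (mem_closedBall_zero_iff.1 hv)

end IsDissipationPotential

end Potential

/-! ### A common superlinear minorant. -/

section Envelope

/-- The supremum of the affine functions `r ↦ n r - c n`. -/
noncomputable def affineEnvelope (c : ℕ → ℝ) (r : ℝ) : ℝ :=
  ⨆ n : ℕ, (n * r - c n)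

variable {c : ℕ → ℝ}

/-- Quadratic growth of `c` keeps the envelope finite, since `n r - n² ≤ r²`. -/
theorem bddAbove_affine (hc : ∀ n : ℕ, (n : ℝ) ^ 2 ≤ c n) (r : ℝ) :
    BddAbove (Set.range fun n : ℕ => (n * r - c n : ℝ)) := by
  refine ⟨r ^ 2, ?_⟩
  rintro _ ⟨n, rfl⟩
  nlinarith [hc n, sq_nonneg ((n : ℝ) - r), sq_nonneg ((n : ℝ)), sq_nonneg r]

theorem affine_le_affineEnvelope (hc : ∀ n : ℕ, (n : ℝ) ^ 2 ≤ c n) (n : ℕ) (r : ℝ) :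
    n * r - c n ≤ affineEnvelope c r :=
  le_ciSup (bddAbove_affine hc r) n

theorem affineEnvelope_le {r b : ℝ} (h : ∀ n : ℕ, n * r - c n ≤ b) : affineEnvelope c r ≤ b :=
  ciSup_le h

theorem affineEnvelope_nonneg (hc : ∀ n : ℕ, (n : ℝ) ^ 2 ≤ c n) (hc0 : c 0 = 0) (r : ℝ) :
    0 ≤ affineEnvelope c r := by
  simpa [hc0] using affine_le_affineEnvelope hc 0 r

theorem monotone_affineEnvelope (hc : ∀ n : ℕ, (n : ℝ) ^ 2 ≤ c n) :
    Monotone (affineEnvelope c) := by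
  refine fun r s hrs => affineEnvelope_le fun n => le_trans ?_ (affine_le_affineEnvelope hc n s)
  gcongr

theorem convexOn_affineEnvelope (hc : ∀ n : ℕ, (n : ℝ) ^ 2 ≤ c n) :
    ConvexOn ℝ Set.univ (affineEnvelope c) := by
  refine ⟨convex_univ, fun r _ s _ a b ha hb hab => affineEnvelope_le fun n => ?_⟩
  have h₁ := mul_le_mul_of_nonneg_left (affine_le_affineEnvelope hc n r) ha
  have h₂ := mul_le_mul_of_nonneg_left (affine_le_affineEnvelope hc n s) hb
  have h₃ : a * c n + b * c n = c n := by rw [← add_mul, hab, one_mul]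
  simp only [smul_eq_mul]
  linarith

theorem tendsto_affineEnvelope_div (hc : ∀ n : ℕ, (n : ℝ) ^ 2 ≤ c n) :
    Tendsto (fun r => affineEnvelope c r / r) atTop atTop := by
  refine tendsto_atTop.2 fun b => ?_
  -- One affine piece suffices: the spare unit of slope absorbs `c n` once `r ≥ c n`.
  obtain ⟨n, hn⟩ := exists_nat_ge (b + 1)
  filter_upwards [eventually_ge_atTop (max 1 (c n))] with r hr
  have hr1 : 1 ≤ r := (le_max_left _ _).trans hr
  have hrc : c n ≤ r := (le_max_right _ _).trans hr
  rw [le_div_iff₀ (by linarith)]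
  have h₁ := affine_le_affineEnvelope hc n r
  have h₂ : (b + 1) * r ≤ n * r := mul_le_mul_of_nonneg_right hn (by linarith)
  linarith

end Envelope

variable {X₁ X₂ : Type*} [NormedAddCommGroup X₁] [NormedSpace ℝ X₁]
  [NormedAddCommGroup X₂] [NormedSpace ℝ X₂]

/-- Two dissipation potentials have a common superlinear minorant. -/
theorem exists_isSuperlinearMinorant {R₁ : X₁ → ℝ} {R₂ : X₂ → ℝ}
    (hR₁ : IsDissipationPotential R₁) (hR₂ : IsDissipationPotential R₂) :
    ∃ Ψ : ℝ → ℝ, IsSuperlinearMinorant R₁ R₂ Ψ := by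
  obtain ⟨S₁, hS₁, hS₁0, hS₁t⟩ := hR₁.exists_real_conjugate
  obtain ⟨S₂, hS₂, hS₂0, hS₂t⟩ := hR₂.exists_real_conjugate
  choose a ha0 ha using fun n : ℕ => exists_mul_norm_sub_le hR₁.nonneg hR₁.superlinear n
  choose b hb0 hb using fun n : ℕ => exists_mul_norm_sub_le hR₂.nonneg hR₂.superlinear n
  choose a' ha0' ha' using fun n : ℕ => exists_mul_norm_sub_le hS₁0 hS₁t n
  choose b' hb0' hb' using fun n : ℕ => exists_mul_norm_sub_le hS₂0 hS₂t n
  -- Summing the four nonnegative constants puts each affine piece below all four functionals; `n ^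
  -- 2` ensures finiteness, and `c 0 = 0` makes the envelope nonnegative.
  let c : ℕ → ℝ := fun n => if n = 0 then 0 else a n + b n + a' n + b' n + (n : ℝ) ^ 2
  have hc0 : c 0 = 0 := if_pos rfl
  have hcn (n : ℕ) (hn : n ≠ 0) : c n = a n + b n + a' n + b' n + (n : ℝ) ^ 2 := if_neg hn
  have hc (n : ℕ) : (n : ℝ) ^ 2 ≤ c n := by
    rcases eq_or_ne n 0 with rfl | hn
    · simp [hc0]
    · rw [hcn n hn]
      linarith [ha0 n, hb0 n, ha0' n, hb0' n]
  have key (d : ℕ → ℝ) (hd : ∀ n, n ≠ 0 → d n ≤ c n) (r x : ℝ) (hx : 0 ≤ x)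
      (h : ∀ n : ℕ, n * r - d n ≤ x) : affineEnvelope c r ≤ x := by
    refine affineEnvelope_le fun n => ?_
    rcases eq_or_ne n 0 with rfl | hn
    · simpa [hc0] using hx
    · linarith [hd n hn, h n]
  have hsq (n : ℕ) : 0 ≤ (n : ℝ) ^ 2 := sq_nonneg _
  refine ⟨affineEnvelope c, fun r _ => affineEnvelope_nonneg hc hc0 r,
    (convexOn_affineEnvelope hc).subset (Set.subset_univ _) (convex_Ici 0),
    (monotone_affineEnvelope hc).monotoneOn _, tendsto_affineEnvelope_div hc,
    fun v => ?_, fun v => ?_, fun ξ => ?_, fun ξ => ?_⟩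
  · refine key a (fun n hn => ?_) _ _ (hR₁.nonneg v) fun n => ha n v
    linarith [hcn n hn, ha0 n, hb0 n, ha0' n, hb0' n, hsq n]
  · refine key b (fun n hn => ?_) _ _ (hR₂.nonneg v) fun n => hb n v
    linarith [hcn n hn, ha0 n, hb0 n, ha0' n, hb0' n, hsq n]
  · rw [hS₁, EReal.coe_le_coe_iff]
    refine key a' (fun n hn => ?_) _ _ (hS₁0 ξ) fun n => ha' n ξ
    linarith [hcn n hn, ha0 n, hb0 n, ha0' n, hb0' n, hsq n]
  · rw [hS₂, EReal.coe_le_coe_iff]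
    refine key b' (fun n hn => ?_) _ _ (hS₂0 ξ) fun n => hb' n ξ
    linarith [hcn n hn, ha0 n, hb0 n, ha0' n, hb0' n, hsq n]

/-! ### Two-sided bounds from a minorant. -/

theorem IsSuperlinearMinorant.le_halfLineConjugate {R₁ : X₁ → ℝ} {R₂ : X₂ → ℝ} {Ψ : ℝ → ℝ}
    (hΨ : IsSuperlinearMinorant R₁ R₂ Ψ) (hR₁ : IsDissipationPotential R₁) (v : X₁) :
    (R₁ v : EReal) ≤ halfLineConjugate Ψ ‖v‖ := by
  obtain ⟨S, hS, -, -⟩ := hR₁.exists_real_conjugate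
  -- Testing against real `b` above the supremum avoids proving it finite; `r = ‖ξ‖` is the relevant
  -- competitor.
  refine EReal.le_of_forall_lt_iff_le.1 fun b hb => EReal.coe_le_coe_iff.2 ?_
  refine hR₁.le_of_forall_sub_conjugate_le hS fun ξ => ?_
  have h₁ : ((‖ξ‖ * ‖v‖ - Ψ ‖ξ‖ : ℝ) : EReal) ≤ b :=
    (le_iSup (fun r : Set.Ici (0 : ℝ) => (((r : ℝ) * ‖v‖ - Ψ r : ℝ) : EReal))
      ⟨‖ξ‖, norm_nonneg ξ⟩).trans hb.le
  have h₂ := hΨ.le_conjugate₁ ξ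
  rw [hS] at h₂
  rw [EReal.coe_le_coe_iff] at h₁ h₂
  linarith [(le_abs_self (ξ v)).trans (ξ.le_opNorm v)]

/-- As `1 ≤ CN`, both summands of `v` are controlled by the same constant; the halves in the
argument are the weights of midpoint convexity. -/
theorem IsSuperlinearMinorant.two_mul_le_add {R₁ : X₁ → ℝ} {R₂ : X₂ → ℝ} {Ψ : ℝ → ℝ}
    (hΨ : IsSuperlinearMinorant R₁ R₂ Ψ) (ι : X₂ →L[ℝ] X₁) {CN : ℝ} (hCN : 1 ≤ CN)
    (hnorm : ∀ w : X₂, ‖ι w‖ ≤ CN * ‖w‖) (v : X₁) (w : X₂) :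
    2 * Ψ (1 / (2 * CN) * ‖v‖) ≤ R₁ (v - ι w) + R₂ w := by
  have hC0 : 0 < CN := by linarith
  have h₁ : ‖v‖ ≤ CN * (‖v - ι w‖ + ‖w‖) := by
    have h₂ : ‖v‖ ≤ ‖v - ι w‖ + ‖ι w‖ := by
      simpa using norm_add_le (v - ι w) (ι w)
    nlinarith [hnorm w, norm_nonneg (v - ι w)]
  have h₂ : 1 / (2 * CN) * ‖v‖ ≤ (1 / 2 : ℝ) * ‖v - ι w‖ + (1 / 2 : ℝ) * ‖w‖ := by
    rw [one_div_mul_eq_div, div_le_iff₀ (by positivity)]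
    linarith
  have h₃ := hΨ.mono (Set.mem_Ici.2 (by positivity)) (Set.mem_Ici.2 (by positivity)) h₂
  have h₄ := hΨ.convex.2 (Set.mem_Ici.2 (norm_nonneg (v - ι w))) (Set.mem_Ici.2 (norm_nonneg w))
    (by norm_num : (0 : ℝ) ≤ 1 / 2) (by norm_num : (0 : ℝ) ≤ 1 / 2) (by norm_num)
  simp only [smul_eq_mul] at h₄
  linarith [hΨ.le₁ (v - ι w), hΨ.le₂ w]

/-! ### The infimal convolution: attainment, convexity, conjugate. -/

theorem effectivePotential_le (ι : X₂ →L[ℝ] X₁) (hι : Function.Injective ι) (R₁ : X₁ → ℝ)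
    (R₂ : X₂ → ℝ) (v : X₁) (w : X₂) :
    effectivePotential ι R₁ R₂ v ≤ ((R₁ (v - ι w) + R₂ w : ℝ) : EReal) := by
  refine (iInf₂_le ((v - ι w, ι w) : X₁ × X₁) (sub_add_cancel v (ι w))).trans_eq ?_
  simp only [extendByTop, hι.extend_apply, EReal.coe_add]

theorem le_effectivePotential (ι : X₂ →L[ℝ] X₁) (hι : Function.Injective ι) (R₁ : X₁ → ℝ)
    (R₂ : X₂ → ℝ) {v : X₁} {b : ℝ} (h : ∀ w, b ≤ R₁ (v - ι w) + R₂ w) :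
    (b : EReal) ≤ effectivePotential ι R₁ R₂ v := by
  refine le_iInf₂ fun p hp => ?_
  by_cases hex : ∃ w, ι w = p.2
  · obtain ⟨w, hw⟩ := hex
    rw [← hw, extendByTop, hι.extend_apply, ← EReal.coe_add, EReal.coe_le_coe_iff,
      eq_sub_of_add_eq hp, ← hw]
    exact h w
  · rw [extendByTop, Function.extend_apply' _ _ _ hex, EReal.coe_add_top]
    exact le_top

/-- The infimal convolution is real-valued and attained. -/
theorem exists_real_effectivePotential (hX₂ : IsReflexive X₂) (ι : X₂ →L[ℝ] X₁)
    (hι : Function.Injective ι) {R₁ : X₁ → ℝ} {R₂ : X₂ → ℝ}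
    (hR₁ : IsDissipationPotential R₁) (hR₂ : IsDissipationPotential R₂) :
    ∃ (e : X₁ → ℝ) (m : X₁ → X₂), (∀ v, effectivePotential ι R₁ R₂ v = (e v : EReal)) ∧
      (∀ v, e v = R₁ (v - ι (m v)) + R₂ (m v)) ∧ ∀ v w, e v ≤ R₁ (v - ι w) + R₂ w := by
  have hex (v : X₁) : ∃ m : X₂, ∀ w, R₁ (v - ι m) + R₂ m ≤ R₁ (v - ι w) + R₂ w := by
    refine hX₂.exists_forall_le ?_ ?_ ?_
    · refine ConvexOn.add ⟨convex_univ, fun x _ y _ a b ha hb hab => ?_⟩ hR₂.convex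
      have heq : v - ι (a • x + b • y) = a • (v - ι x) + b • (v - ι y) := by
        have hv : v = a • v + b • v := by rw [← add_smul, hab, one_smul]
        rw [map_add, map_smul, map_smul, smul_sub, smul_sub]
        nth_rewrite 1 [hv]
        abel
      change R₁ (v - ι (a • x + b • y)) ≤ _
      rw [heq]
      exact hR₁.convex.2 (Set.mem_univ _) (Set.mem_univ _) ha hb hab
    · exact (hR₁.continuous.comp (continuous_const.sub ι.continuous)).lowerSemicontinuous.add
        hR₂.lsc
    -- Coercivity in `w` comes from `R₂` alone, because `R₁ ≥ 0`.
    · obtain ⟨C, -, hC⟩ := exists_mul_norm_sub_le hR₂.nonneg hR₂.superlinear 1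
      refine tendsto_atTop_mono (fun w => ?_)
        (tendsto_atTop_add_const_right _ (-C) tendsto_norm_cobounded_atTop)
      linarith [hC w, hR₁.nonneg (v - ι w)]
  choose m hm using hex
  exact ⟨fun v => R₁ (v - ι (m v)) + R₂ (m v), m,
    fun v => le_antisymm (effectivePotential_le ι hι R₁ R₂ v (m v))
      (le_effectivePotential ι hι R₁ R₂ (hm v)), fun _ => rfl, hm⟩

/-- The marginal of a jointly convex sum is convex. -/
theorem convexOn_of_attained_infConv {ι : X₂ →L[ℝ] X₁} {R₁ : X₁ → ℝ} {R₂ : X₂ → ℝ}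
    (hR₁ : ConvexOn ℝ Set.univ R₁) (hR₂ : ConvexOn ℝ Set.univ R₂) {e : X₁ → ℝ} {m : X₁ → X₂}
    (hm : ∀ v, e v = R₁ (v - ι (m v)) + R₂ (m v)) (hle : ∀ v w, e v ≤ R₁ (v - ι w) + R₂ w) :
    ConvexOn ℝ Set.univ e := by
  refine ⟨convex_univ, fun x _ y _ a b ha hb hab => ?_⟩
  have h := hle (a • x + b • y) (a • m x + b • m y)
  have heq : a • x + b • y - ι (a • m x + b • m y) = a • (x - ι (m x)) + b • (y - ι (m y)) := by
    rw [map_add, map_smul, map_smul, smul_sub, smul_sub]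
    abel
  rw [heq] at h
  have h₁ := hR₁.2 (Set.mem_univ (x - ι (m x))) (Set.mem_univ (y - ι (m y))) ha hb hab
  have h₂ := hR₂.2 (Set.mem_univ (m x)) (Set.mem_univ (m y)) ha hb hab
  rw [hm x, hm y]
  simp only [smul_eq_mul] at h₁ h₂ ⊢
  linarith

/-- The conjugate of an infimal convolution is the sum of the conjugates. -/
theorem conjugate_of_attained_infConv {ι : X₂ →L[ℝ] X₁} {R₁ : X₁ → ℝ} {R₂ : X₂ → ℝ}
    {e : X₁ → ℝ} {m : X₁ → X₂} (hm : ∀ v, e v = R₁ (v - ι (m v)) + R₂ (m v))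
    (hle : ∀ v w, e v ≤ R₁ (v - ι w) + R₂ w) {ξ : StrongDual ℝ X₁} {s₁ s₂ : ℝ}
    (h₁ : conjugate (fun v => (R₁ v : EReal)) ξ = (s₁ : EReal))
    (h₂ : conjugate (fun w => (R₂ w : EReal)) (ξ.comp ι) = (s₂ : EReal)) :
    conjugate (fun v => (e v : EReal)) ξ = ((s₁ + s₂ : ℝ) : EReal) := by
  refine le_antisymm (conjugate_le_coe fun v => ?_) ?_
  · have h₃ := coe_sub_le_conjugate R₁ ξ (v - ι (m v))
    have h₄ := coe_sub_le_conjugate R₂ (ξ.comp ι) (m v)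
    rw [h₁, EReal.coe_le_coe_iff, map_sub] at h₃
    rw [h₂, EReal.coe_le_coe_iff, ContinuousLinearMap.comp_apply] at h₄
    linarith [hm v]
  · refine EReal.le_of_forall_lt_iff_le.1 fun b hb => EReal.coe_le_coe_iff.2 ?_
    -- Testing at `v + ι w` leaves `v` and `w` free, so the suprema can be taken one after the
    -- other.
    have hsum (v : X₁) (w : X₂) : (ξ v - R₁ v) + (ξ (ι w) - R₂ w) ≤ b := by
      have h₃ := (coe_sub_le_conjugate e ξ (v + ι w)).trans hb.le
      rw [EReal.coe_le_coe_iff, map_add] at h₃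
      have h₄ := hle (v + ι w) w
      rw [add_sub_cancel_right] at h₄
      linarith
    have h₃ (w : X₂) : s₁ ≤ b - (ξ (ι w) - R₂ w) := by
      rw [← EReal.coe_le_coe_iff, ← h₁]
      exact conjugate_le_coe fun v => by linarith [hsum v w]
    have h₄ : s₂ ≤ b - s₁ := by
      rw [← EReal.coe_le_coe_iff, ← h₂]
      refine conjugate_le_coe fun w => ?_
      rw [ContinuousLinearMap.comp_apply]
      linarith [h₃ w]
    linarith

end InfConvolution

theorem mainTheorem7 {X₁ X₂ : Type*}
    [NormedAddCommGroup X₁] [NormedSpace ℝ X₁] [CompleteSpace X₁]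
    [NormedAddCommGroup X₂] [NormedSpace ℝ X₂] [CompleteSpace X₂]
    (hX₁ : InfConvolution.IsReflexive X₁) (hX₂ : InfConvolution.IsReflexive X₂)
    -- the dense and continuous embedding of `X₂` into `X₁`
    (ι : X₂ →L[ℝ] X₁) (hι : Function.Injective ι) (hdense : DenseRange ι)
    (CN : ℝ) (hCN : 1 ≤ CN) (hnorm : ∀ w : X₂, ‖ι w‖ ≤ CN * ‖w‖)
    (R₁ : X₁ → ℝ) (R₂ : X₂ → ℝ)
    (hR₁ : InfConvolution.IsDissipationPotential R₁)
    (hR₂ : InfConvolution.IsDissipationPotential R₂) :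
    -- the effective potential takes values in `[0, ∞)`
    (∀ v, 0 ≤ InfConvolution.effectivePotential ι R₁ R₂ v ∧
      InfConvolution.effectivePotential ι R₁ R₂ v < ⊤) ∧
    -- the infimum is a minimum
    (∀ v, ∃ v₁ v₂ : X₁, v₁ + v₂ = v ∧
      InfConvolution.effectivePotential ι R₁ R₂ v =
        (R₁ v₁ : EReal) + InfConvolution.extendByTop ι R₂ v₂) ∧
    -- lower semicontinuity and convexity
    LowerSemicontinuous (InfConvolution.effectivePotential ι R₁ R₂) ∧
    ConvexOn ℝ Set.univ (fun v => (InfConvolution.effectivePotential ι R₁ R₂ v).toReal) ∧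
    -- the conjugate is finite and equals `R₁* + R₂*`, where `ξ ∈ X₁*` acts on `X₂` as `ξ ∘ ι`
    (∀ ξ : StrongDual ℝ X₁,
      InfConvolution.conjugate (InfConvolution.effectivePotential ι R₁ R₂) ξ =
          InfConvolution.conjugate (fun v => (R₁ v : EReal)) ξ +
            InfConvolution.conjugate (fun w => (R₂ w : EReal)) (ξ.comp ι) ∧
        0 ≤ InfConvolution.conjugate (InfConvolution.effectivePotential ι R₁ R₂) ξ ∧
        InfConvolution.conjugate (InfConvolution.effectivePotential ι R₁ R₂) ξ < ⊤) ∧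
    -- a superlinear minorant exists, and each of them gives the two-sided bounds
    (∃ Ψ : ℝ → ℝ, InfConvolution.IsSuperlinearMinorant R₁ R₂ Ψ) ∧
    (∀ Ψ : ℝ → ℝ, InfConvolution.IsSuperlinearMinorant R₁ R₂ Ψ → ∀ v : X₁,
      ((2 * Ψ (1 / (2 * CN) * ‖v‖) : ℝ) : EReal) ≤ InfConvolution.effectivePotential ι R₁ R₂ v ∧
      InfConvolution.effectivePotential ι R₁ R₂ v ≤ (R₁ v : EReal) ∧
      (R₁ v : EReal) ≤ InfConvolution.halfLineConjugate Ψ ‖v‖) := by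
  obtain ⟨e, m, he, hm, hle⟩ :=
    InfConvolution.exists_real_effectivePotential hX₂ ι hι hR₁ hR₂
  obtain ⟨S₁, hS₁, hS₁0, -⟩ := hR₁.exists_real_conjugate
  obtain ⟨S₂, hS₂, hS₂0, -⟩ := hR₂.exists_real_conjugate
  have hfun : InfConvolution.effectivePotential ι R₁ R₂ = fun v => (e v : EReal) := funext he
  have he0 (v : X₁) : 0 ≤ e v := by
    rw [hm v]
    exact add_nonneg (hR₁.nonneg _) (hR₂.nonneg _)
  have heR (v : X₁) : e v ≤ R₁ v := by simpa [hR₂.zero] using hle v 0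
  have hconv : ConvexOn ℝ Set.univ e :=
    InfConvolution.convexOn_of_attained_infConv hR₁.convex hR₂.convex hm hle
  have hcont : Continuous e := by
    refine hconv.continuous_of_isBoundedUnder (x₀ := 0) ?_
    exact hR₁.continuous.continuousAt.isBoundedUnder_le.mono_le (Eventually.of_forall heR)
  rw [hfun]
  refine ⟨fun v => ⟨EReal.coe_nonneg.2 (he0 v), EReal.coe_lt_top _⟩, fun v => ?_, ?_, hconv,
    fun ξ => ?_, InfConvolution.exists_isSuperlinearMinorant hR₁ hR₂,
    fun Ψ hΨ v => ⟨?_, EReal.coe_le_coe_iff.2 (heR v), hΨ.le_halfLineConjugate hR₁ v⟩⟩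
  · refine ⟨v - ι (m v), ι (m v), sub_add_cancel _ _, ?_⟩
    rw [InfConvolution.extendByTop, hι.extend_apply, ← EReal.coe_add, ← hm v]
  · exact (continuous_coe_real_ereal.comp hcont).lowerSemicontinuous
  · rw [InfConvolution.conjugate_of_attained_infConv hm hle (hS₁ ξ) (hS₂ (ξ.comp ι)), hS₁, hS₂]
    exact ⟨EReal.coe_add _ _, EReal.coe_nonneg.2 (add_nonneg (hS₁0 _) (hS₂0 _)),
      EReal.coe_lt_top _⟩
  · rw [EReal.coe_le_coe_iff, hm v]
    exact hΨ.two_mul_le_add ι hCN hnorm v (m v)
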